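/- Let $\delta\in(0,1)$, let $k=\lceil 200\log(2/\delta)\rceil$, and let $n\ge 1$ be divisible by $k$. Let $X_1,\dots,X_n$ be i.i.d. random vectors in $\mathbb{R}^d$ with $\mathbb{E}\|X_1\|^2<\infty$, mean $\mu$ and covariance matrix $\Sigma$; write $\lambda_{\max}$ for the largest eigenvalue of $\Sigma$ and $\|\cdot\|$ for the Euclidean norm. Partition $\{1,\dots,n\}$ into $k$ disjoint blocks $B_1,\dots,B_k$ of size $m=n/k$ each, and put $Z_j=\frac1m\sum_{i\in B_j}X_i$. For $a\in\mathbb{R}^d$ let $$T_a=\Big\{x\in\mathbb{R}^d:\ \exists J\subseteq\{1,\dots,k\},\ |J|\ge k/2,\ \|Z_j-x\|\le\|Z_j-a\|\ \text{ for all } j\in J\Big\},\qquad \mathrm{radius}(T_a)=\sup_{x\in T_a}\|x-a\|.$$ Then the minimum of $a\mapsto\mathrm{radius}(T_a)$ over $\mathbb{R}^d$ is always attained, and for every choice of a minimizer $\widehat\mu_n\in\operatorname{argmin}_{a\in\mathbb{R}^d}\mathrm{radius}(T_a)$ (the median-of-means tournament estimator), with probability at least $1-\delta$, $$\|\widehat\mu_n-\mu\|\le\max\left(960\sqrt{\frac{\mathrm{Tr}(\Sigma)}{n}},\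 240\sqrt{\frac{\lambda_{\max}\log(2/\delta)}{n}}\right).$$ -/

import Mathlib

open MeasureTheory ProbabilityTheory

noncomputable section

namespace MedianOfMeans

/-- The blocks `B 1, …, B k` form a partition of the index set `{1, …, n}` into `k` disjoint blocks
of the same size `n / k` (used for `k ∣ n`, so that the division is exact). -/
def IsEqualPartition {n k : ℕ} (B : Fin k → Finset (Fin n)) : Prop :=
  (∀ i j : Fin k, i ≠ j → Disjoint (B i) (B j)) ∧
    (∀ i : Fin n, ∃ j : Fin k, i ∈ B j) ∧ ∀ j : Fin k, (B j).card = n / k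

/-- The sample mean `Z j` of the data `x` within the block `B j`. -/
def blockMean {d n k : ℕ} (B : Fin k → Finset (Fin n)) (x : Fin n → EuclideanSpace ℝ (Fin d))
    (j : Fin k) : EuclideanSpace ℝ (Fin d) :=
  ((B j).card : ℝ)⁻¹ • ∑ i ∈ B j, x i

/-- The set `T_a` of all points `x` such that `‖Z j - x‖ ≤ ‖Z j - a‖` for all `j` in some set of at
least `k / 2` blocks. -/
def tournamentSet {d k : ℕ} (Z : Fin k → EuclideanSpace ℝ (Fin d))
    (a : EuclideanSpace ℝ (Fin d)) : Set (EuclideanSpace ℝ (Fin d)) :=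
  {x | ∃ J : Finset (Fin k), (k : ℝ) / 2 ≤ (J.card : ℝ) ∧ ∀ j ∈ J, ‖Z j - x‖ ≤ ‖Z j - a‖}

/-- `radius (T_a) = sup_{x ∈ T_a} ‖x - a‖`. For `k ≥ 1` the set `T_a` contains `a` and is bounded,
so that this is a genuine supremum of real numbers. -/
def tournamentRadius {d k : ℕ} (Z : Fin k → EuclideanSpace ℝ (Fin d))
    (a : EuclideanSpace ℝ (Fin d)) : ℝ :=
  sSup ((fun x => ‖x - a‖) '' tournamentSet Z a)

/-- The set `argmin_a radius (T_a)`. -/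
def tournamentArgmin {d k : ℕ} (Z : Fin k → EuclideanSpace ℝ (Fin d)) :
    Set (EuclideanSpace ℝ (Fin d)) :=
  {a | ∀ b, tournamentRadius Z a ≤ tournamentRadius Z b}

/-- The covariance matrix of the random vector `X`. -/
def covMatrix {Ω : Type*} [MeasurableSpace Ω] {d : ℕ} (X : Ω → EuclideanSpace ℝ (Fin d))
    (P : Measure Ω) : Matrix (Fin d) (Fin d) ℝ :=
  Matrix.of fun i j => covariance (fun ω => X ω i) (fun ω => X ω j) P

/-- The largest (real) eigenvalue of a square matrix. A covariance matrix is symmetric, so for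
`d ≥ 1` its set of real eigenvalues is finite and nonempty and this is its maximum; for `d = 0` the
value is `0`. -/
def lambdaMax {d : ℕ} (A : Matrix (Fin d) (Fin d) ℝ) : ℝ :=
  sSup {c : ℝ | Module.End.HasEigenvalue (Matrix.toLin' A) c}

end MedianOfMeans

end

/-!
Write `y j = Z j - μ` for the centred block means, and let `r` be the claimed bound.

*Deterministic part.* A minimizer of `radius (T_a)` exists because the radius is lower
semicontinuous and coercive. If in no unit direction `u` half of the `y j` satisfy
`⟪y j, u⟫ > r / 2`, then `radius (T_μ) ≤ r` (`tournamentRadius_le`). Of the minimizer and `μ`, one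
lies in the tournament set of the other, and both radii are at most `r`, so the minimizer is within
`r` of `μ` (`norm_sub_le_of_mem_tournamentArgmin`).

*Uniform deviation.* What remains is to control, simultaneously for all unit vectors `u`, the number
`N(u)` of indices `j` with `⟪y j, u⟫ > R`, where `R = r / 2`. This is done by Gaussian smoothing of
the direction, in the spirit of PAC-Bayesian bounds, in place of a covering or chaining argument.
Consider the random variable
`W = ∫ exp (N(x) - b ‖x‖²) dx` with `b = k / 8`, and let `I = ∫ exp (-b ‖x‖²) dx`.

* If `N(u) ≥ k / 2` for a single unit vector `u`, then `W ≥ exp (k / 4 - b) I = exp (k / 8) I`.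
  To see this, translate the integral by `u` and average over `x` and `-x`: one of `u + x`, `u - x`
  exceeds the level `R` whenever `u` does, so `N(u + x) + N(u - x) ≥ N(u)`, and the arithmetic mean
  of the two integrands is at least their geometric mean, from which the linear terms `± 2 b ⟪u, x⟫`
  have cancelled (`exp_mul_lintegral_le_lintegral_exceedCount`).
* For fixed `x` the independence of the blocks gives
  `E exp N(x) ≤ exp (2 k E⟪y 1, x⟫² / R²)`. The exponent is a quadratic form, diagonal in an
  eigenbasis of the covariance matrix, and the Gaussian integral of its exponential is a product of
  one-dimensional integrals. It converges because `r` dominates `√(λ_max log (2 / δ) / n)`, and it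
  is at most `exp (k / 100) I` because `r` dominates `√(Tr Σ / n)`
  (`lintegral_partitionFunction_le`).

Markov's inequality for `W` then bounds the probability of the exceptional event by
`exp (k / 100 - k / 8)`, which is at most `δ` since `k ≥ 200 log (2 / δ)`.
-/

namespace MedianOfMeans

open scoped RealInnerProductSpace ENNReal

/-! ### Tournament sets and their radius -/

section Deterministic

variable {d k : ℕ} (Z : Fin k → EuclideanSpace ℝ (Fin d)) (a : EuclideanSpace ℝ (Fin d))

lemma self_mem_tournamentSet : a ∈ tournamentSet Z a :=
  ⟨Finset.univ, by simp, fun _ _ => le_rfl⟩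

variable {a} in
lemma exists_norm_sub_le_of_mem_tournamentSet (hk : 0 < k) {x : EuclideanSpace ℝ (Fin d)}
    (hx : x ∈ tournamentSet Z a) : ∃ j, ‖Z j - x‖ ≤ ‖Z j - a‖ := by
  obtain ⟨J, hJ, h⟩ := hx
  have hk' : (0 : ℝ) < k := by exact_mod_cast hk
  have : 0 < J.card := by
    have : (0 : ℝ) < J.card := by linarith
    exact_mod_cast this
  obtain ⟨j, hj⟩ := Finset.card_pos.1 this
  exact ⟨j, h j hj⟩

lemma bddAbove_tournament (hk : 0 < k) :
    BddAbove ((fun x => ‖x - a‖) '' tournamentSet Z a) := by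
  refine ⟨2 * ∑ j, ‖Z j - a‖, ?_⟩
  rintro _ ⟨x, hx, rfl⟩
  obtain ⟨j, hj⟩ := exists_norm_sub_le_of_mem_tournamentSet Z hk hx
  have h1 : ‖Z j - a‖ ≤ ∑ j, ‖Z j - a‖ :=
    Finset.single_le_sum (f := fun j => ‖Z j - a‖) (fun _ _ => norm_nonneg _) (Finset.mem_univ j)
  have h2 : ‖x - a‖ ≤ ‖Z j - x‖ + ‖Z j - a‖ := by
    have := norm_sub_le (Z j - a) (Z j - x)
    rw [sub_sub_sub_cancel_left] at this
    linarith
  change ‖x - a‖ ≤ _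
  linarith

variable {a} in
lemma norm_sub_le_tournamentRadius (hk : 0 < k) {x : EuclideanSpace ℝ (Fin d)}
    (hx : x ∈ tournamentSet Z a) : ‖x - a‖ ≤ tournamentRadius Z a :=
  le_csSup (bddAbove_tournament Z a hk) ⟨x, hx, rfl⟩

/-- If `x ≠ a` lies in `T_a` then, by strict convexity of the Euclidean balls, points of the open
segment from `x` to `a` lie in the interior of the balls defining `T_a`, hence in `T_b` for all `b`
close to `a`. The radius can therefore only jump downwards in the limit. -/
lemma lowerSemicontinuous_tournamentRadius (hk : 0 < k) :
    LowerSemicontinuous (tournamentRadius Z) := by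
  intro a y hy
  obtain ⟨_, ⟨x, ⟨J, hJ, hJx⟩, rfl⟩, hyx⟩ :=
    exists_lt_of_lt_csSup (Set.Nonempty.image _ ⟨a, self_mem_tournamentSet Z a⟩) hy
  change y < ‖x - a‖ at hyx
  by_cases hxa : x = a
  · subst hxa
    simp only [sub_self, norm_zero] at hyx
    refine Filter.Eventually.of_forall fun b => hyx.trans_le ?_
    simpa using norm_sub_le_tournamentRadius Z hk (self_mem_tournamentSet Z b)
  -- a point of the open segment that is still further than `y` from `a`
  obtain ⟨t, ht0, ht1, hty⟩ : ∃ t : ℝ, 0 < t ∧ t < 1 ∧ y < (1 - t) * ‖x - a‖ := by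
    have hc : Filter.Tendsto (fun t : ℝ => (1 - t) * ‖x - a‖) (nhdsWithin 0 (Set.Ioi 0))
        (nhds ((1 - 0) * ‖x - a‖)) :=
      (Continuous.tendsto (by fun_prop) 0).mono_left nhdsWithin_le_nhds
    have h1 := hc.eventually (lt_mem_nhds (a := y) (by simpa using hyx))
    have h2 : Set.Ioo (0 : ℝ) 1 ∈ nhdsWithin (0 : ℝ) (Set.Ioi 0) := Ioo_mem_nhdsGT one_pos
    obtain ⟨t, h3, h4⟩ := (h1.and h2).exists
    exact ⟨t, h4.1, h4.2, h3⟩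
  set z := (1 - t) • x + t • a with hz
  have hza : ‖z - a‖ = (1 - t) * ‖x - a‖ := by
    have : z - a = (1 - t) • (x - a) := by rw [hz]; module
    rw [this, norm_smul, Real.norm_of_nonneg (by linarith)]
  have hstrict : ∀ j ∈ J, ‖Z j - z‖ < ‖Z j - a‖ := by
    intro j hj
    have e : Z j - z = (1 - t) • (Z j - x) + t • (Z j - a) := by rw [hz]; module
    rw [e]
    exact norm_combo_lt_of_ne (hJx j hj) le_rfl (fun h => hxa (sub_right_injective h))
      (by linarith) ht0 (by ring)
  have hev : ∀ᶠ b in nhds a, ∀ j ∈ J, ‖Z j - z‖ < ‖Z j - b‖ := by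
    rw [Filter.eventually_all_finset]
    intro j hj
    exact (Continuous.tendsto (f := fun b => ‖Z j - b‖) (by fun_prop) a).eventually
      (lt_mem_nhds (hstrict j hj))
  have hev2 : ∀ᶠ b in nhds a, y < ‖z - b‖ :=
    (Continuous.tendsto (f := fun b => ‖z - b‖) (by fun_prop) a).eventually
      (lt_mem_nhds (hza ▸ hty))
  filter_upwards [hev, hev2] with b h1 h2
  exact h2.trans_le (norm_sub_le_tournamentRadius Z hk ⟨J, hJ, fun j hj => (h1 j hj).le⟩)

/-- The radius grows at least like `‖a‖`, since the origin lies in `T_a` for large `a`. -/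
lemma norm_le_tournamentRadius (hk : 0 < k) (ha : 2 * ∑ j, ‖Z j‖ ≤ ‖a‖) :
    ‖a‖ ≤ tournamentRadius Z a := by
  have h0 : (0 : EuclideanSpace ℝ (Fin d)) ∈ tournamentSet Z a := by
    refine ⟨Finset.univ, by simp, fun j _ => ?_⟩
    have h1 : ‖Z j‖ ≤ ∑ j, ‖Z j‖ :=
      Finset.single_le_sum (f := fun j => ‖Z j‖) (fun _ _ => norm_nonneg _) (Finset.mem_univ j)
    have h2 := norm_sub_norm_le a (Z j)
    rw [norm_sub_rev] at h2
    rw [sub_zero]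
    linarith
  simpa using norm_sub_le_tournamentRadius Z hk h0

/-- The tournament radius is lower semicontinuous and coercive, so its minimum is attained. -/
theorem tournamentArgmin_nonempty (hk : 0 < k) : (tournamentArgmin Z).Nonempty := by
  set ρ := max (2 * ∑ j, ‖Z j‖) (tournamentRadius Z 0) with hρ
  have hρ0 : 0 ≤ ρ := le_max_of_le_left (by positivity)
  obtain ⟨a, -, hmin⟩ := LowerSemicontinuousOn.exists_isMinOn (f := tournamentRadius Z)
    (s := Metric.closedBall 0 ρ) ⟨0, by simpa using hρ0⟩ (isCompact_closedBall 0 ρ)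
    ((lowerSemicontinuous_tournamentRadius Z hk).lowerSemicontinuousOn _)
  refine ⟨a, fun b => ?_⟩
  by_cases hb : b ∈ Metric.closedBall (0 : EuclideanSpace ℝ (Fin d)) ρ
  · exact hmin hb
  · have hb' : ρ < ‖b‖ := by simpa using hb
    calc tournamentRadius Z a ≤ tournamentRadius Z 0 := hmin (by simpa using hρ0)
      _ ≤ ρ := le_max_right _ _
      _ ≤ ‖b‖ := hb'.le
      _ ≤ tournamentRadius Z b :=
        norm_le_tournamentRadius Z b hk ((le_max_left _ _).trans hb'.le)

/-- The number of points `y j` that exceed the level `R` in the direction `x`, as a real number. -/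
noncomputable def exceedCount (R : ℝ) (y : Fin k → EuclideanSpace ℝ (Fin d))
    (x : EuclideanSpace ℝ (Fin d)) : ℝ :=
  ∑ j, if R < ⟪y j, x⟫ then 1 else 0

lemma card_le_exceedCount {R : ℝ} {y : Fin k → EuclideanSpace ℝ (Fin d)}
    {x : EuclideanSpace ℝ (Fin d)} {J : Finset (Fin k)} (hJ : ∀ j ∈ J, R < ⟪y j, x⟫) :
    (J.card : ℝ) ≤ exceedCount R y x := by
  have h : (J.card : ℝ) = ∑ j ∈ J, if R < ⟪y j, x⟫ then (1 : ℝ) else 0 := by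
    rw [Finset.sum_congr rfl fun j hj => if_pos (hJ j hj)]
    simp
  rw [h]
  refine Finset.sum_le_sum_of_subset_of_nonneg (Finset.subset_univ _) fun j _ _ => ?_
  split_ifs <;> norm_num

/-- If in no direction half of the points exceed `r / 2` when centred at `μ`, then `μ` wins the
tournament against every point at distance more than `r`, and `T_μ` has radius at most `r`. -/
lemma tournamentRadius_le {μ : EuclideanSpace ℝ (Fin d)} {r : ℝ} (hr : 0 ≤ r)
    (h : ∀ u : EuclideanSpace ℝ (Fin d), ‖u‖ = 1 →
      exceedCount (r / 2) (fun j => Z j - μ) u < (k : ℝ) / 2) :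
    tournamentRadius Z μ ≤ r := by
  refine csSup_le (Set.Nonempty.image _ ⟨μ, self_mem_tournamentSet Z μ⟩) ?_
  rintro _ ⟨x, ⟨J, hJ, hJx⟩, rfl⟩
  change ‖x - μ‖ ≤ r
  by_contra! hlt
  have hpos : 0 < ‖x - μ‖ := hr.trans_lt hlt
  refine (h (‖x - μ‖⁻¹ • (x - μ)) ?_).not_ge (hJ.trans (card_le_exceedCount fun j hj => ?_))
  · rw [norm_smul, norm_inv, norm_norm, inv_mul_cancel₀ hpos.ne']
  · have h1 := hJx j hj
    have h2 : ‖Z j - x‖ ^ 2 ≤ ‖Z j - μ‖ ^ 2 := by gcongr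
    have h3 : Z j - x = (Z j - μ) - (x - μ) := by abel
    rw [h3, norm_sub_sq_real] at h2
    rw [real_inner_smul_right, inv_mul_eq_div, lt_div_iff₀ hpos]
    nlinarith

/-- Of any two points, one lies in the tournament set of the other. So a minimizer of the radius is
within `radius (T_μ)` of any point `μ`. -/
lemma norm_sub_le_of_mem_tournamentArgmin (hk : 0 < k) {a : EuclideanSpace ℝ (Fin d)}
    (ha : a ∈ tournamentArgmin Z) (μ : EuclideanSpace ℝ (Fin d)) :
    ‖a - μ‖ ≤ tournamentRadius Z μ := by
  classical
  set J := Finset.univ.filter fun j => ‖Z j - μ‖ ≤ ‖Z j - a‖ with hJdef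
  by_cases hJ : (k : ℝ) / 2 ≤ J.card
  · rw [norm_sub_rev]
    refine (norm_sub_le_tournamentRadius Z hk ⟨J, hJ, fun j hj => ?_⟩).trans (ha μ)
    exact (Finset.mem_filter.1 hj).2
  · refine norm_sub_le_tournamentRadius Z hk ⟨Jᶜ, ?_, fun j hj => ?_⟩
    · have h1 := Finset.card_add_card_compl J
      rw [Fintype.card_fin] at h1
      have h2 : (J.card : ℝ) + (Jᶜ.card : ℝ) = k := by exact_mod_cast h1
      linarith
    · have : ¬ ‖Z j - μ‖ ≤ ‖Z j - a‖ := by simpa [hJdef] using hj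
      exact (not_le.1 this).le

end Deterministic

/-! ### Gaussian integrals of exponentials of quadratic forms -/

section Gaussian

variable {d : ℕ}

lemma lintegral_exp_quadratic (e : OrthonormalBasis (Fin d) ℝ (EuclideanSpace ℝ (Fin d)))
    {b : ℝ} {c : Fin d → ℝ} (hc : ∀ i, c i < b) :
    ∫⁻ x : EuclideanSpace ℝ (Fin d),
      ENNReal.ofReal (Real.exp (∑ i, c i * ⟪e i, x⟫ ^ 2 - b * ‖x‖ ^ 2)) =
      ENNReal.ofReal (∏ i, √(Real.pi / (b - c i))) := by
  have h1 : ∀ x : EuclideanSpace ℝ (Fin d),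
      Real.exp (∑ i, c i * ⟪e i, x⟫ ^ 2 - b * ‖x‖ ^ 2) =
        ∏ i, Real.exp (-(b - c i) * (e.repr x i) ^ 2) := by
    intro x
    rw [← Real.exp_sum, ← e.sum_sq_inner_right x, Finset.mul_sum, ← Finset.sum_sub_distrib]
    congr 1
    refine Finset.sum_congr rfl fun i _ => ?_
    rw [e.repr_apply_apply]
    ring
  have hint : ∀ i, Integrable fun y : ℝ => Real.exp (-(b - c i) * y ^ 2) := fun i =>
    integrable_exp_neg_mul_sq (sub_pos.2 (hc i))
  simp_rw [h1]
  rw [e.measurePreserving_repr.lintegral_comp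
      (f := fun x => ENNReal.ofReal (∏ i, Real.exp (-(b - c i) * (x i) ^ 2))) (by fun_prop),
    ← (PiLp.volume_preserving_toLp (Fin d)).lintegral_comp (by fun_prop),
    ← ofReal_integral_eq_lintegral_ofReal]
  · congr 1
    simp only
    rw [integral_fintype_prod_volume_eq_prod (fun i (y : ℝ) => Real.exp (-(b - c i) * y ^ 2))]
    exact Finset.prod_congr rfl fun i _ => integral_gaussian _
  · exact Integrable.fintype_prod hint
  · exact Filter.Eventually.of_forall fun x => by positivity

/-- The exponential moment of a diagonal quadratic form under a Gaussian weight, in the regime where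
the form takes up at most half of the Gaussian exponent. -/
lemma lintegral_exp_quadratic_le (e : OrthonormalBasis (Fin d) ℝ (EuclideanSpace ℝ (Fin d)))
    {b : ℝ} (hb : 0 < b) {c : Fin d → ℝ} (hc0 : ∀ i, 0 ≤ c i) (hc : ∀ i, c i ≤ b / 2) :
    ∫⁻ x : EuclideanSpace ℝ (Fin d),
      ENNReal.ofReal (Real.exp (∑ i, c i * ⟪e i, x⟫ ^ 2 - b * ‖x‖ ^ 2)) ≤
      ENNReal.ofReal (Real.exp ((∑ i, c i) / b)) *
        ∫⁻ x : EuclideanSpace ℝ (Fin d), ENNReal.ofReal (Real.exp (-b * ‖x‖ ^ 2)) := by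
  have h0 := lintegral_exp_quadratic e (b := b) (c := fun _ => 0) fun _ => hb
  simp only [zero_mul, Finset.sum_const_zero, zero_sub, ← neg_mul, sub_zero] at h0
  rw [lintegral_exp_quadratic e (fun i => (hc i).trans_lt (half_lt_self hb)), h0,
    ← ENNReal.ofReal_mul (Real.exp_pos _).le, Finset.sum_div, Real.exp_sum,
    ← Finset.prod_mul_distrib]
  refine ENNReal.ofReal_le_ofReal (Finset.prod_le_prod (fun i _ => by positivity) fun i _ => ?_)
  set y := c i / b with hy
  have hcy : c i = y * b := by rw [hy]; field_simp
  have hy0 : 0 ≤ y := div_nonneg (hc0 i) hb.le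
  have hy1 : y ≤ 1 / 2 := by rw [hy, div_le_iff₀ hb]; linarith [hc i]
  have key : Real.pi / (b - c i) ≤ Real.exp y ^ 2 * (Real.pi / b) := by
    have h1 : 1 ≤ Real.exp y ^ 2 * (1 - y) := by
      rw [← Real.exp_nat_mul]
      have := Real.add_one_le_exp ((2 : ℕ) * y)
      push_cast at this ⊢
      nlinarith
    have hbc : b - c i = b * (1 - y) := by rw [hcy]; ring
    rw [hbc, div_le_iff₀ (by nlinarith)]
    have : Real.exp y ^ 2 * (Real.pi / b) * (b * (1 - y)) =
        Real.pi * (Real.exp y ^ 2 * (1 - y)) := by field_simp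
    rw [this]
    nlinarith [Real.pi_pos]
  calc √(Real.pi / (b - c i)) ≤ √(Real.exp y ^ 2 * (Real.pi / b)) := Real.sqrt_le_sqrt key
    _ = Real.exp y * √(Real.pi / b) := by
      rw [Real.sqrt_mul (by positivity), Real.sqrt_sq (Real.exp_pos _).le]

lemma lintegral_exp_neg_mul_norm_sq_ne_zero {b : ℝ} (hb : 0 < b) :
    ∫⁻ x : EuclideanSpace ℝ (Fin d), ENNReal.ofReal (Real.exp (-b * ‖x‖ ^ 2)) ≠ 0 := by
  have h0 := lintegral_exp_quadratic (EuclideanSpace.basisFun (Fin d) ℝ) (b := b)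
    (c := fun _ => 0) fun _ => hb
  simp only [zero_mul, Finset.sum_const_zero, zero_sub, ← neg_mul, sub_zero] at h0
  rw [h0]
  simp only [ne_eq, ENNReal.ofReal_eq_zero, not_le]
  positivity

lemma lintegral_exp_neg_mul_norm_sq_ne_top {b : ℝ} (hb : 0 < b) :
    ∫⁻ x : EuclideanSpace ℝ (Fin d), ENNReal.ofReal (Real.exp (-b * ‖x‖ ^ 2)) ≠ ∞ := by
  have h0 := lintegral_exp_quadratic (EuclideanSpace.basisFun (Fin d) ℝ) (b := b)
    (c := fun _ => 0) fun _ => hb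
  simp only [zero_mul, Finset.sum_const_zero, zero_sub, ← neg_mul, sub_zero] at h0
  rw [h0]
  exact ENNReal.ofReal_ne_top

end Gaussian

/-! ### Gaussian smoothing of the exceedance count -/

section Smoothing

variable {d k : ℕ}

lemma measurable_exceedCount {α : Type*} [MeasurableSpace α] (R : ℝ)
    {y : α → Fin k → EuclideanSpace ℝ (Fin d)} {x : α → EuclideanSpace ℝ (Fin d)}
    (hy : ∀ j, Measurable fun a => y a j) (hx : Measurable x) :
    Measurable fun a => exceedCount R (y a) (x a) := by
  unfold exceedCount
  refine Finset.measurable_sum _ fun j _ => Measurable.ite ?_ measurable_const measurable_const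
  exact measurableSet_lt measurable_const ((hy j).inner hx)

lemma exceedCount_le_add_sub (R : ℝ) (y : Fin k → EuclideanSpace ℝ (Fin d))
    (u x : EuclideanSpace ℝ (Fin d)) :
    exceedCount R y u ≤ exceedCount R y (u + x) + exceedCount R y (u - x) := by
  unfold exceedCount
  rw [← Finset.sum_add_distrib]
  refine Finset.sum_le_sum fun j _ => ?_
  rw [inner_add_right, inner_sub_right]
  split_ifs <;> first | (exfalso; linarith) | norm_num

/-- The partition function of the exceedance count under a Gaussian weight dominates every single
direction `u`: translating the weight by `u` costs `b`, the linear term `⟪u, x⟫` of the translated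
exponent cancels on averaging over `x` and `-x`, and one of `u + x` and `u - x` exceeds the level
whenever `u` does. -/
lemma exp_mul_lintegral_le_lintegral_exceedCount (R b : ℝ)
    (y : Fin k → EuclideanSpace ℝ (Fin d)) {u : EuclideanSpace ℝ (Fin d)} (hu : ‖u‖ = 1) :
    ENNReal.ofReal (Real.exp (exceedCount R y u / 2 - b)) *
        ∫⁻ x : EuclideanSpace ℝ (Fin d), ENNReal.ofReal (Real.exp (-b * ‖x‖ ^ 2)) ≤
      ∫⁻ x : EuclideanSpace ℝ (Fin d),
        ENNReal.ofReal (Real.exp (exceedCount R y x - b * ‖x‖ ^ 2)) := by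
  set F : EuclideanSpace ℝ (Fin d) → ℝ≥0∞ := fun x =>
    ENNReal.ofReal (Real.exp (exceedCount R y x - b * ‖x‖ ^ 2)) with hF
  have hFm : Measurable F := by
    have := measurable_exceedCount R (y := fun _ : EuclideanSpace ℝ (Fin d) => y) (x := id)
      (fun _ => measurable_const) measurable_id
    simp only [id] at this
    fun_prop
  have hpt : ∀ x, ENNReal.ofReal 2 * (ENNReal.ofReal (Real.exp (exceedCount R y u / 2 - b)) *
      ENNReal.ofReal (Real.exp (-b * ‖x‖ ^ 2))) ≤ F (u + x) + F (u - x) := by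
    intro x
    rw [← ENNReal.ofReal_mul (Real.exp_pos _).le, ← ENNReal.ofReal_mul zero_le_two,
      ← Real.exp_add, hF, ← ENNReal.ofReal_add (Real.exp_pos _).le (Real.exp_pos _).le]
    refine ENNReal.ofReal_le_ofReal ?_
    set A := exceedCount R y (u + x) - b * ‖u + x‖ ^ 2
    set A' := exceedCount R y (u - x) - b * ‖u - x‖ ^ 2
    have hsum : exceedCount R y u / 2 - b + -b * ‖x‖ ^ 2 ≤ (A + A') / 2 := by
      have h3 := exceedCount_le_add_sub R y u x
      have h4 : ‖u + x‖ ^ 2 + ‖u - x‖ ^ 2 = 2 + 2 * ‖x‖ ^ 2 := by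
        rw [norm_add_sq_real, norm_sub_sq_real, hu]; ring
      have h5 : A + A' = exceedCount R y (u + x) + exceedCount R y (u - x) -
          b * (‖u + x‖ ^ 2 + ‖u - x‖ ^ 2) := by simp only [A, A']; ring
      rw [h5, h4]
      linarith
    calc 2 * Real.exp (exceedCount R y u / 2 - b + -b * ‖x‖ ^ 2)
        ≤ 2 * Real.exp ((A + A') / 2) := by gcongr
      _ = 2 * Real.exp (A / 2) * Real.exp (A' / 2) := by
        rw [mul_assoc, ← Real.exp_add]; ring_nf
      _ ≤ Real.exp (A / 2) ^ 2 + Real.exp (A' / 2) ^ 2 := two_mul_le_add_sq _ _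
      _ = Real.exp A + Real.exp A' := by
        rw [← Real.exp_nat_mul, ← Real.exp_nat_mul]; push_cast; ring_nf
  have hdouble : ENNReal.ofReal 2 * (ENNReal.ofReal (Real.exp (exceedCount R y u / 2 - b)) *
      ∫⁻ x : EuclideanSpace ℝ (Fin d), ENNReal.ofReal (Real.exp (-b * ‖x‖ ^ 2))) ≤
      ENNReal.ofReal 2 * ∫⁻ x, F x := by
    calc _ = ∫⁻ x : EuclideanSpace ℝ (Fin d),
          ENNReal.ofReal 2 * (ENNReal.ofReal (Real.exp (exceedCount R y u / 2 - b)) *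
            ENNReal.ofReal (Real.exp (-b * ‖x‖ ^ 2))) := by
          rw [lintegral_const_mul _ (by fun_prop), lintegral_const_mul _ (by fun_prop)]
      _ ≤ ∫⁻ x, (F (u + x) + F (u - x)) := lintegral_mono hpt
      _ = ENNReal.ofReal 2 * ∫⁻ x, F x := by
          rw [lintegral_add_left (by fun_prop), lintegral_add_left_eq_self,
            lintegral_sub_left_eq_self, ENNReal.ofReal_ofNat, two_mul]
  exact (ENNReal.mul_le_mul_iff_right (by simp) ENNReal.ofReal_ne_top).1 hdouble

end Smoothing

/-! ### Independence of functions of disjoint blocks -/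

section Independence

variable {Ω ι κ E F : Type*} [MeasurableSpace Ω] [MeasurableSpace E] [MeasurableSpace F]
  {P : Measure Ω}

/-- Functions of disjoint blocks of mutually independent random variables are mutually
independent. -/
lemma iIndepFun_of_pairwise_disjoint {X : ι → Ω → E} (hX : iIndepFun X P)
    (hXm : ∀ i, Measurable (X i)) {B : κ → Finset ι} (hB : ∀ i j, i ≠ j → Disjoint (B i) (B j))
    {φ : ∀ j, (B j → E) → F} (hφ : ∀ j, Measurable (φ j)) :
    iIndepFun (fun j ω => φ j fun i => X i ω) P := by
  classical
  have := hX.isProbabilityMeasure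
  rw [iIndepFun_iff_measure_inter_preimage_eq_mul]
  intro s sets hsets
  induction s using Finset.induction_on with
  | empty => simp
  | insert a s ha ih =>
    rw [Finset.prod_insert ha, Finset.set_biInter_insert,
      ← ih fun i hi => hsets i (Finset.mem_insert_of_mem hi)]
    have hdisj : Disjoint (B a) (s.biUnion B) := by
      rw [Finset.disjoint_biUnion_right]
      exact fun j hj => hB a j fun h => ha (h ▸ hj)
    have hind := hX.indepFun_finset (B a) (s.biUnion B) hdisj hXm
    -- the event of the blocks in `s`, as an event about the tuple of all their variables
    let G : Set (↥(s.biUnion B) → E) :=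
      ⋂ j : s, {y | φ j (fun i => y ⟨i, Finset.mem_biUnion.2 ⟨j, j.2, i.2⟩⟩) ∈ sets j}
    have hG : MeasurableSet G := by
      refine MeasurableSet.iInter fun j => ?_
      refine ((hφ j).comp ?_) (hsets j (Finset.mem_insert_of_mem j.2))
      exact measurable_pi_lambda _ fun i => measurable_pi_apply _
    have hGeq : (⋂ j ∈ s, (fun ω => φ j fun i => X i ω) ⁻¹' sets j) =
        (fun ω (i : ↥(s.biUnion B)) => X i ω) ⁻¹' G := by
      ext ω
      simp [G]
    rw [hGeq]
    exact hind.measure_inter_preimage_eq_mul (φ a ⁻¹' sets a) G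
      (hφ a (hsets a (Finset.mem_insert_self _ _))) hG

end Independence

/-! ### Uniform deviation over directions -/

section UniformDeviation

variable {Ω : Type*} [MeasurableSpace Ω] {P : Measure Ω} [IsProbabilityMeasure P] {d k : ℕ}

/-- The integral of `exp (exceedCount R y)` against the unnormalized Gaussian weight
`exp (-b ‖x‖²)`, for fixed data `y`. -/
noncomputable def partitionFunction (R b : ℝ) (y : Fin k → EuclideanSpace ℝ (Fin d)) : ℝ≥0∞ :=
  ∫⁻ x : EuclideanSpace ℝ (Fin d), ENNReal.ofReal (Real.exp (exceedCount R y x - b * ‖x‖ ^ 2))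

lemma measurable_uncurry_exp_exceedCount (R b : ℝ) {Y : Fin k → Ω → EuclideanSpace ℝ (Fin d)}
    (hY : ∀ j, Measurable (Y j)) :
    Measurable (Function.uncurry fun ω (x : EuclideanSpace ℝ (Fin d)) =>
      ENNReal.ofReal (Real.exp (exceedCount R (fun j => Y j ω) x - b * ‖x‖ ^ 2))) := by
  have h := measurable_exceedCount R
    (y := fun (p : Ω × EuclideanSpace ℝ (Fin d)) j => Y j p.1) (x := fun p => p.2)
    (fun j => (hY j).comp measurable_fst) measurable_snd
  simp only [Function.uncurry_def]
  fun_prop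

/-- Exponential moment of the exceedance count in a fixed direction: each of the `k` independent
indicators satisfies `exp 1_{R < t} ≤ 1 + 2 t² / R²`, as `e ≤ 3`. -/
lemma lintegral_exp_exceedCount_le {R : ℝ} (hR : 0 < R)
    {Y : Fin k → Ω → EuclideanSpace ℝ (Fin d)} (hY : ∀ j, Measurable (Y j))
    (hind : iIndepFun Y P) {q : ℝ} (x : EuclideanSpace ℝ (Fin d))
    (hq : ∀ j, ∫⁻ ω, ENNReal.ofReal (⟪Y j ω, x⟫ ^ 2) ∂P ≤ ENNReal.ofReal q) (hq0 : 0 ≤ q) :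
    ∫⁻ ω, ENNReal.ofReal (Real.exp (exceedCount R (fun j => Y j ω) x)) ∂P ≤
      ENNReal.ofReal (Real.exp (2 * k / R ^ 2 * q)) := by
  set f : EuclideanSpace ℝ (Fin d) → ℝ≥0∞ := fun y =>
    ENNReal.ofReal (Real.exp (if R < ⟪y, x⟫ then 1 else 0)) with hf
  have hfm : Measurable f := by
    have : Measurable fun y : EuclideanSpace ℝ (Fin d) => if R < ⟪y, x⟫ then (1 : ℝ) else 0 :=
      Measurable.ite (measurableSet_lt measurable_const (by fun_prop)) measurable_const
        measurable_const
    fun_prop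
  have hprod : ∀ ω, ENNReal.ofReal (Real.exp (exceedCount R (fun j => Y j ω) x)) =
      ∏ j, f (Y j ω) := by
    intro ω
    rw [exceedCount, Real.exp_sum, ENNReal.ofReal_prod_of_nonneg fun _ _ => (Real.exp_pos _).le]
  have hsingle : ∀ j, ∫⁻ ω, f (Y j ω) ∂P ≤ ENNReal.ofReal (Real.exp (2 / R ^ 2 * q)) := by
    intro j
    calc ∫⁻ ω, f (Y j ω) ∂P
        ≤ ∫⁻ ω, (1 + ENNReal.ofReal (2 / R ^ 2) * ENNReal.ofReal (⟪Y j ω, x⟫ ^ 2)) ∂P := by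
          refine lintegral_mono fun ω => ?_
          rw [← ENNReal.ofReal_one, ← ENNReal.ofReal_mul (by positivity),
            ← ENNReal.ofReal_add zero_le_one (by positivity)]
          refine ENNReal.ofReal_le_ofReal ?_
          split_ifs with h
          · have h1 := Real.exp_one_lt_d9
            have h2 : 1 ≤ ⟪Y j ω, x⟫ ^ 2 / R ^ 2 := by
              rw [le_div_iff₀ (by positivity), one_mul]; gcongr
            have h3 : 2 / R ^ 2 * ⟪Y j ω, x⟫ ^ 2 = 2 * (⟪Y j ω, x⟫ ^ 2 / R ^ 2) := by ring
            linarith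
          · rw [Real.exp_zero]
            have : 0 ≤ 2 / R ^ 2 * ⟪Y j ω, x⟫ ^ 2 := by positivity
            linarith
      _ = 1 + ENNReal.ofReal (2 / R ^ 2) * ∫⁻ ω, ENNReal.ofReal (⟪Y j ω, x⟫ ^ 2) ∂P := by
          have hm : Measurable fun ω => ENNReal.ofReal (⟪Y j ω, x⟫ ^ 2) := by
            have := hY j
            fun_prop
          rw [lintegral_add_left measurable_const, lintegral_const_mul _ hm]
          simp
      _ ≤ 1 + ENNReal.ofReal (2 / R ^ 2) * ENNReal.ofReal q := by gcongr; exact hq j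
      _ ≤ ENNReal.ofReal (Real.exp (2 / R ^ 2 * q)) := by
          rw [← ENNReal.ofReal_one, ← ENNReal.ofReal_mul (by positivity),
            ← ENNReal.ofReal_add zero_le_one (by positivity)]
          refine ENNReal.ofReal_le_ofReal ?_
          linarith [Real.add_one_le_exp (2 / R ^ 2 * q)]
  calc ∫⁻ ω, ENNReal.ofReal (Real.exp (exceedCount R (fun j => Y j ω) x)) ∂P
      = ∏ j, ∫⁻ ω, f (Y j ω) ∂P := by
        simp_rw [hprod]
        exact lintegral_prod_eq_prod_lintegral_of_indepFun Finset.univ (fun j ω => f (Y j ω))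
          (hind.comp (fun _ => f) fun _ => hfm) fun j => hfm.comp (hY j)
    _ ≤ ∏ _j : Fin k, ENNReal.ofReal (Real.exp (2 / R ^ 2 * q)) :=
        Finset.prod_le_prod' fun j _ => hsingle j
    _ = ENNReal.ofReal (Real.exp (2 * k / R ^ 2 * q)) := by
        rw [Finset.prod_const, Finset.card_univ, Fintype.card_fin,
          ← ENNReal.ofReal_pow (Real.exp_pos _).le, ← Real.exp_nat_mul]
        congr 2
        ring

/-- The expected partition function, for data whose second moments are at most a quadratic form that
is diagonal in the orthonormal basis `e`. -/
lemma lintegral_partitionFunction_le {R b : ℝ} (hR : 0 < R) (hb : 0 < b)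
    {Y : Fin k → Ω → EuclideanSpace ℝ (Fin d)} (hY : ∀ j, Measurable (Y j))
    (hind : iIndepFun Y P) (e : OrthonormalBasis (Fin d) ℝ (EuclideanSpace ℝ (Fin d)))
    {a : Fin d → ℝ} (ha0 : ∀ i, 0 ≤ a i) (ha : ∀ i, 2 * k / R ^ 2 * a i ≤ b / 2)
    (hmom : ∀ j x, ∫⁻ ω, ENNReal.ofReal (⟪Y j ω, x⟫ ^ 2) ∂P ≤
      ENNReal.ofReal (∑ i, a i * ⟪e i, x⟫ ^ 2)) :
    ∫⁻ ω, partitionFunction R b (fun j => Y j ω) ∂P ≤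
      ENNReal.ofReal (Real.exp (2 * k / R ^ 2 * (∑ i, a i) / b)) *
        ∫⁻ x : EuclideanSpace ℝ (Fin d), ENNReal.ofReal (Real.exp (-b * ‖x‖ ^ 2)) := by
  unfold partitionFunction
  rw [lintegral_lintegral_swap (measurable_uncurry_exp_exceedCount R b hY).aemeasurable]
  refine le_trans (lintegral_mono fun x => ?_)
    ((lintegral_exp_quadratic_le e hb (c := fun i => 2 * k / R ^ 2 * a i)
      (fun i => mul_nonneg (by positivity) (ha0 i)) ha).trans_eq ?_)
  · have hq0 : 0 ≤ ∑ i, a i * ⟪e i, x⟫ ^ 2 :=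
      Finset.sum_nonneg fun i _ => mul_nonneg (ha0 i) (sq_nonneg _)
    have hm : Measurable fun ω =>
        ENNReal.ofReal (Real.exp (exceedCount R (fun j => Y j ω) x)) := by
      have := measurable_exceedCount R (y := fun ω j => Y j ω) (x := fun _ => x) hY
        measurable_const
      fun_prop
    calc ∫⁻ ω, ENNReal.ofReal (Real.exp (exceedCount R (fun j => Y j ω) x - b * ‖x‖ ^ 2)) ∂P
        = (∫⁻ ω, ENNReal.ofReal (Real.exp (exceedCount R (fun j => Y j ω) x)) ∂P) *
            ENNReal.ofReal (Real.exp (-(b * ‖x‖ ^ 2))) := by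
          rw [← lintegral_mul_const _ hm]
          refine lintegral_congr fun ω => ?_
          rw [← ENNReal.ofReal_mul (Real.exp_pos _).le, ← Real.exp_add, sub_eq_add_neg]
      _ ≤ ENNReal.ofReal (Real.exp (2 * k / R ^ 2 * ∑ i, a i * ⟪e i, x⟫ ^ 2)) *
            ENNReal.ofReal (Real.exp (-(b * ‖x‖ ^ 2))) := by
          gcongr
          exact lintegral_exp_exceedCount_le hR hY hind x (fun j => hmom j x) hq0
      _ = _ := by
          rw [← ENNReal.ofReal_mul (Real.exp_pos _).le, ← Real.exp_add, ← sub_eq_add_neg,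
            Finset.mul_sum]
          simp only [mul_assoc]
  · rw [Finset.mul_sum]

/-- With high probability no direction is exceeded by half of the points. The bound is uniform over
the sphere: on the exceptional event the partition function with `b = k / 8` is larger than its
expectation by a factor exponential in `k`, and Markov's inequality applies. -/
theorem measure_exists_half_le_exceedCount_le {R : ℝ} (hR : 0 < R) (hk : 0 < k)
    {Y : Fin k → Ω → EuclideanSpace ℝ (Fin d)} (hY : ∀ j, Measurable (Y j))
    (hind : iIndepFun Y P) (e : OrthonormalBasis (Fin d) ℝ (EuclideanSpace ℝ (Fin d)))
    {a : Fin d → ℝ} (ha0 : ∀ i, 0 ≤ a i) (ha : ∀ i, 32 * a i ≤ R ^ 2)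
    (hmom : ∀ j x, ∫⁻ ω, ENNReal.ofReal (⟪Y j ω, x⟫ ^ 2) ∂P ≤
      ENNReal.ofReal (∑ i, a i * ⟪e i, x⟫ ^ 2)) :
    P {ω | ∃ u : EuclideanSpace ℝ (Fin d), ‖u‖ = 1 ∧
        (k : ℝ) / 2 ≤ exceedCount R (fun j => Y j ω) u} ≤
      ENNReal.ofReal (Real.exp (16 * (∑ i, a i) / R ^ 2 - k / 8)) := by
  have hk' : (0 : ℝ) < k := by exact_mod_cast hk
  set b : ℝ := k / 8 with hb
  have hb0 : 0 < b := by positivity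
  set I := ∫⁻ x : EuclideanSpace ℝ (Fin d), ENNReal.ofReal (Real.exp (-b * ‖x‖ ^ 2)) with hI
  have hI0 : I ≠ 0 := lintegral_exp_neg_mul_norm_sq_ne_zero hb0
  have hItop : I ≠ ∞ := lintegral_exp_neg_mul_norm_sq_ne_top hb0
  have hexp0 : ENNReal.ofReal (Real.exp b) ≠ 0 := by
    simpa using Real.exp_pos b
  have hsub : {ω | ∃ u : EuclideanSpace ℝ (Fin d), ‖u‖ = 1 ∧
        (k : ℝ) / 2 ≤ exceedCount R (fun j => Y j ω) u} ⊆
      {ω | ENNReal.ofReal (Real.exp b) * I ≤ partitionFunction R b (fun j => Y j ω)} := by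
    rintro ω ⟨u, hu, hcount⟩
    refine le_trans ?_ (exp_mul_lintegral_le_lintegral_exceedCount R b (fun j => Y j ω) hu)
    gcongr
    linarith
  have hWm : Measurable fun ω => partitionFunction R b (fun j => Y j ω) :=
    (measurable_uncurry_exp_exceedCount R b hY).lintegral_prod_right'
  have hW := lintegral_partitionFunction_le hR hb0 hY hind e ha0 (fun i => ?_) hmom
  · calc _ ≤ P {ω | ENNReal.ofReal (Real.exp b) * I ≤ partitionFunction R b (fun j => Y j ω)} :=
          measure_mono hsub
      _ ≤ (∫⁻ ω, partitionFunction R b (fun j => Y j ω) ∂P) / (ENNReal.ofReal (Real.exp b) * I) :=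
          meas_ge_le_lintegral_div hWm.aemeasurable (mul_ne_zero hexp0 hI0)
            (ENNReal.mul_ne_top ENNReal.ofReal_ne_top hItop)
      _ ≤ (ENNReal.ofReal (Real.exp (2 * k / R ^ 2 * (∑ i, a i) / b)) * I) /
            (ENNReal.ofReal (Real.exp b) * I) := by gcongr
      _ = ENNReal.ofReal (Real.exp (16 * (∑ i, a i) / R ^ 2 - b)) := by
          rw [ENNReal.mul_div_mul_right _ _ hI0 hItop, ← ENNReal.ofReal_div_of_pos (Real.exp_pos _),
            ← Real.exp_sub]
          congr 3
          rw [hb]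
          field_simp
          ring
  · have h1 : 2 * k / R ^ 2 * a i = k / 16 * (32 * a i / R ^ 2) := by ring
    have h2 : 32 * a i / R ^ 2 ≤ 1 := (div_le_one (by positivity)).2 (ha i)
    rw [h1, hb]
    nlinarith

end UniformDeviation

/-! ### Covariance matrices as quadratic forms -/

section Covariance

variable {Ω : Type*} [MeasurableSpace Ω] {P : Measure Ω} [IsProbabilityMeasure P] {d : ℕ}

lemma covMatrix_isHermitian (X : Ω → EuclideanSpace ℝ (Fin d)) (P : Measure Ω) :
    (covMatrix X P).IsHermitian := by
  ext i j
  simp [covMatrix, covariance_comm]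

lemma variance_inner_eq {X : Ω → EuclideanSpace ℝ (Fin d)} (hX : MemLp X 2 P)
    (x : EuclideanSpace ℝ (Fin d)) :
    Var[fun ω => ⟪X ω, x⟫; P] = ⟪x, Matrix.toEuclideanLin (covMatrix X P) x⟫ := by
  have hXi : ∀ i, MemLp (fun ω => x i * X ω i) 2 P := fun i => (hX.eval_piLp i).const_mul _
  have hin : (fun ω => ⟪X ω, x⟫) = fun ω => ∑ i, x i * X ω i := by
    ext ω
    simp [PiLp.inner_apply]
  rw [hin, ← covariance_self (memLp_finsetSum _ fun i _ => hXi i).aemeasurable,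
    covariance_fun_sum_fun_sum hXi hXi, PiLp.inner_apply]
  refine Finset.sum_congr rfl fun i _ => ?_
  simp only [covariance_const_mul_left, covariance_const_mul_right, Matrix.toLpLin_apply,
    Matrix.mulVec, dotProduct, covMatrix, Matrix.of_apply, RCLike.inner_apply, conj_trivial]
  rw [Finset.sum_mul]
  exact Finset.sum_congr rfl fun j _ => by ring

lemma inner_toEuclideanLin_eq_sum {S : Matrix (Fin d) (Fin d) ℝ} (hS : S.IsHermitian)
    (x : EuclideanSpace ℝ (Fin d)) :
    ⟪x, Matrix.toEuclideanLin S x⟫ =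
      ∑ i, hS.eigenvalues i * ⟪hS.eigenvectorBasis i, x⟫ ^ 2 := by
  rw [← hS.eigenvectorBasis.sum_inner_mul_inner]
  refine Finset.sum_congr rfl fun i _ => ?_
  have hsymm := (Matrix.isSymmetric_toEuclideanLin_iff.2 hS) (hS.eigenvectorBasis i) x
  have heig : Matrix.toEuclideanLin S (hS.eigenvectorBasis i) =
      hS.eigenvalues i • hS.eigenvectorBasis i := by
    rw [Matrix.toLpLin_apply, hS.mulVec_eigenvectorBasis]
    rfl
  rw [← hsymm, heig, real_inner_smul_left, real_inner_comm x]
  ring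

lemma eigenvalues_covMatrix_nonneg {X : Ω → EuclideanSpace ℝ (Fin d)} (hX : MemLp X 2 P)
    (hS : (covMatrix X P).IsHermitian) (i : Fin d) : 0 ≤ hS.eigenvalues i := by
  have h := variance_inner_eq hX (hS.eigenvectorBasis i)
  rw [inner_toEuclideanLin_eq_sum hS] at h
  simp only [OrthonormalBasis.inner_eq_ite, ite_pow, one_pow, ne_eq, OfNat.ofNat_ne_zero,
    not_false_eq_true, zero_pow, mul_ite, mul_one, mul_zero, Finset.sum_ite_eq', Finset.mem_univ,
    if_true] at h
  exact h ▸ variance_nonneg _ _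

lemma eigenvalues_le_lambdaMax {S : Matrix (Fin d) (Fin d) ℝ} (hS : S.IsHermitian) (i : Fin d) :
    hS.eigenvalues i ≤ lambdaMax S := by
  refine le_csSup (Module.End.finite_hasEigenvalue (Matrix.toLin' S)).bddAbove ?_
  refine Module.End.hasEigenvalue_of_hasEigenvector
    (x := (hS.eigenvectorBasis i).ofLp) ⟨?_, fun h => ?_⟩
  · rw [Module.End.mem_eigenspace_iff, Matrix.toLin'_apply, hS.mulVec_eigenvectorBasis]
  · exact hS.eigenvectorBasis.orthonormal.ne_zero i ((WithLp.ofLp_eq_zero 2).1 h)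

end Covariance

/-! ### Block means -/

section BlockMeans

variable {Ω : Type*} [MeasurableSpace Ω] {P : Measure Ω} [IsProbabilityMeasure P] {d n k : ℕ}
  {B : Fin k → Finset (Fin n)} {X : Fin n → Ω → EuclideanSpace ℝ (Fin d)}

/-- The second moment of a centred block mean in direction `x` is the variance of a single
observation in that direction, divided by the size of the block. -/
lemma lintegral_inner_blockMean_sub_sq (hindep : iIndepFun X P) (hL2 : ∀ i, MemLp (X i) 2 P)
    {μ : EuclideanSpace ℝ (Fin d)} (hμ : ∀ i, ∫ ω, X i ω ∂P = μ)
    {S : Matrix (Fin d) (Fin d) ℝ} (hS : ∀ i, covMatrix (X i) P = S)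
    {j : Fin k} (hj : 0 < (B j).card) (x : EuclideanSpace ℝ (Fin d)) :
    ∫⁻ ω, ENNReal.ofReal (⟪blockMean B (fun i => X i ω) j - μ, x⟫ ^ 2) ∂P =
      ENNReal.ofReal (((B j).card : ℝ)⁻¹ * ⟪x, Matrix.toEuclideanLin S x⟫) := by
  have hm : ((B j).card : ℝ) ≠ 0 := by exact_mod_cast hj.ne'
  have hin : ∀ i, MemLp (fun ω => ⟪X i ω, x⟫) 2 P := fun i => (hL2 i).inner_const x
  have hmean : ∀ i, ∫ ω, ⟪X i ω, x⟫ ∂P = ⟪μ, x⟫ := by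
    intro i
    simp_rw [real_inner_comm x]
    rw [integral_inner ((hL2 i).integrable one_le_two), hμ]
  have hblock : (fun ω => ⟪blockMean B (fun i => X i ω) j, x⟫) =
      fun ω => ((B j).card : ℝ)⁻¹ * (∑ i ∈ B j, fun ω => ⟪X i ω, x⟫) ω := by
    ext ω
    rw [blockMean, real_inner_smul_left, sum_inner, Finset.sum_apply]
  have hL2block : MemLp (fun ω => ⟪blockMean B (fun i => X i ω) j, x⟫) 2 P := by
    rw [hblock]
    exact (memLp_finsetSum' _ fun i _ => hin i).const_mul _
  have hmeanblock : ∫ ω, ⟪blockMean B (fun i => X i ω) j, x⟫ ∂P = ⟪μ, x⟫ := by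
    rw [hblock, integral_const_mul]
    simp only [Finset.sum_apply]
    rw [integral_finsetSum _ fun i _ => (hin i).integrable one_le_two]
    simp only [hmean, Finset.sum_const, nsmul_eq_mul]
    field_simp
  have hvar : Var[fun ω => ⟪blockMean B (fun i => X i ω) j, x⟫; P] =
      ((B j).card : ℝ)⁻¹ * ⟪x, Matrix.toEuclideanLin S x⟫ := by
    rw [hblock, variance_const_mul, IndepFun.variance_sum fun i _ => hin i]
    · simp only [variance_inner_eq (hL2 _), hS, Finset.sum_const, nsmul_eq_mul]
      field_simp
    · intro i _ i' _ hii
      exact (hindep.indepFun hii).comp (φ := fun y => ⟪y, x⟫) (ψ := fun y => ⟪y, x⟫)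
        (by fun_prop) (by fun_prop)
  rw [← hvar, hL2block.ofReal_variance_eq, evariance_eq_lintegral_ofReal, hmeanblock]
  simp only [inner_sub_left]

/-- The uniform deviation bound for the centred block means. -/
lemma measure_exists_half_le_exceedCount_blockMean_le (hindep : iIndepFun X P)
    (hL2 : ∀ i, MemLp (X i) 2 P) {μ : EuclideanSpace ℝ (Fin d)} (hμ : ∀ i, ∫ ω, X i ω ∂P = μ)
    {S : Matrix (Fin d) (Fin d) ℝ} (hS : ∀ i, covMatrix (X i) P = S)
    (hB : IsEqualPartition B) (hn : 0 < n) (hk : 0 < k) (hkn : k ∣ n) {R : ℝ} (hR : 0 < R)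
    (hlam : 32 * (k / n * lambdaMax S) ≤ R ^ 2) :
    P {ω | ∃ u : EuclideanSpace ℝ (Fin d), ‖u‖ = 1 ∧
        (k : ℝ) / 2 ≤ exceedCount R (fun j => blockMean B (fun i => X i ω) j - μ) u} ≤
      ENNReal.ofReal (Real.exp (16 * (k / n * S.trace) / R ^ 2 - k / 8)) := by
  -- measurable modifications of the observations
  set X' : Fin n → Ω → EuclideanSpace ℝ (Fin d) := fun i => (hL2 i).aestronglyMeasurable.mk (X i)
    with hX'
  have hX'm : ∀ i, Measurable (X' i) := fun i =>
    (hL2 i).aestronglyMeasurable.stronglyMeasurable_mk.measurable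
  have hXX' : ∀ᵐ ω ∂P, ∀ i, X i ω = X' i ω :=
    ae_all_iff.2 fun i => (hL2 i).aestronglyMeasurable.ae_eq_mk
  have hcard : ∀ j, (B j).card = n / k := hB.2.2
  have hnk : 0 < n / k := Nat.div_pos (Nat.le_of_dvd hn hkn) hk
  have hcast : (((n / k : ℕ) : ℝ))⁻¹ = k / n := by
    rw [Nat.cast_div hkn (by exact_mod_cast hk.ne'), inv_div]
  have hherm : S.IsHermitian := hS ⟨0, hn⟩ ▸ covMatrix_isHermitian (X ⟨0, hn⟩) P
  have hev : ∀ i, 0 ≤ hherm.eigenvalues i := by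
    have h := hS ⟨0, hn⟩
    subst h
    exact eigenvalues_covMatrix_nonneg (hL2 ⟨0, hn⟩) hherm
  have htr : S.trace = ∑ i, hherm.eigenvalues i := by
    simpa using hherm.trace_eq_sum_eigenvalues
  set Y : Fin k → Ω → EuclideanSpace ℝ (Fin d) :=
    fun j ω => blockMean B (fun i => X' i ω) j - μ with hY
  have hYm : ∀ j, Measurable (Y j) := by
    intro j
    simp only [hY, blockMean]
    fun_prop
  have hYind : iIndepFun Y P := by
    have h := iIndepFun_of_pairwise_disjoint (hindep.congr fun i => hXX'.mono fun ω h => h i)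
      hX'm hB.1 (φ := fun j (y : B j → EuclideanSpace ℝ (Fin d)) =>
        ((B j).card : ℝ)⁻¹ • ∑ i, y i - μ) (fun j => by fun_prop)
    convert h using 3 with j ω
    simp only [hY, blockMean]
    rw [← Finset.sum_coe_sort]
  have hsum : ∀ j x, ((B j).card : ℝ)⁻¹ * ⟪x, Matrix.toEuclideanLin S x⟫ =
      ∑ i, (k / n * hherm.eigenvalues i) * ⟪hherm.eigenvectorBasis i, x⟫ ^ 2 := by
    intro j x
    rw [hcard, hcast, inner_toEuclideanLin_eq_sum hherm, Finset.mul_sum]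
    exact Finset.sum_congr rfl fun i _ => by ring
  have hmom : ∀ j x, ∫⁻ ω, ENNReal.ofReal (⟪Y j ω, x⟫ ^ 2) ∂P ≤ ENNReal.ofReal
      (∑ i, (k / n * hherm.eigenvalues i) * ⟪hherm.eigenvectorBasis i, x⟫ ^ 2) := by
    intro j x
    rw [← hsum j,
      ← lintegral_inner_blockMean_sub_sq hindep hL2 hμ hS (by rw [hcard]; exact hnk) x]
    refine (lintegral_congr_ae (hXX'.mono fun ω h => ?_)).le
    simp only [hY, h]
  have key := measure_exists_half_le_exceedCount_le hR hk hYm hYind hherm.eigenvectorBasis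
    (a := fun i => k / n * hherm.eigenvalues i) (fun i => mul_nonneg (by positivity) (hev i))
    (fun i => le_trans (by gcongr; exact eigenvalues_le_lambdaMax hherm i) hlam) hmom
  rw [← Finset.mul_sum, ← htr] at key
  refine le_trans (measure_mono_ae (hXX'.mono fun ω h => ?_)) key
  rintro ⟨u, hu, hcount⟩
  refine ⟨u, hu, ?_⟩
  simpa only [hY, h] using hcount

end BlockMeans

/-! ### The tournament estimator -/

/-- The tournament estimator is within any admissible radius `r > 0` of the mean, with the required
probability. -/
lemma measure_lt_norm_sub_le {Ω : Type*} [MeasurableSpace Ω] {P : Measure Ω}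
    [IsProbabilityMeasure P] {d n k : ℕ} {δ : ℝ} (hδ0 : 0 < δ) (hδ1 : δ < 1)
    (hk : k = ⌈200 * Real.log (2 / δ)⌉₊) (hn : 0 < n) (hkn : k ∣ n)
    {B : Fin k → Finset (Fin n)} (hB : IsEqualPartition B)
    {X : Fin n → Ω → EuclideanSpace ℝ (Fin d)}
    (hindep : iIndepFun X P) (hL2 : ∀ i, MemLp (X i) 2 P)
    {μ : EuclideanSpace ℝ (Fin d)} (hμ : ∀ i, ∫ ω, X i ω ∂P = μ)
    {S : Matrix (Fin d) (Fin d) ℝ} (hS : ∀ i, covMatrix (X i) P = S)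
    {μhat : Ω → EuclideanSpace ℝ (Fin d)}
    (hμhat : ∀ ω, μhat ω ∈ tournamentArgmin (blockMean B (fun i => X i ω)))
    {r : ℝ} (hr : 0 < r) (htr : 960 * √(S.trace / n) ≤ r)
    (hlam : 240 * √(lambdaMax S * Real.log (2 / δ) / n) ≤ r) :
    P {ω | r < ‖μhat ω - μ‖} ≤ ENNReal.ofReal δ := by
  set L := Real.log (2 / δ) with hL
  have hn' : (0 : ℝ) < n := by exact_mod_cast hn
  have hlog2 : 0.6931471803 < Real.log 2 := Real.log_two_gt_d9
  have hLδ : L = Real.log 2 - Real.log δ := Real.log_div two_ne_zero hδ0.ne'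
  have hlogδ : Real.log δ < 0 := Real.log_neg hδ0 hδ1
  have hL0 : 0.69 < L := by linarith
  have hkL : 200 * L ≤ k := hk ▸ Nat.le_ceil _
  have hkL' : (k : ℝ) ≤ 202 * L := by
    have := Nat.ceil_lt_add_one (a := 200 * L) (by positivity)
    rw [← hk] at this
    linarith
  have hk0' : (0 : ℝ) < k := by linarith
  have hk0 : 0 < k := by exact_mod_cast hk0'
  -- for `t < 0`, where `√t` is the junk value `0`, the squared bound holds trivially
  have hsq : ∀ {c t : ℝ}, 0 < c → c * √t ≤ r → c ^ 2 * t ≤ r ^ 2 := by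
    intro c t hc h
    rcases le_or_gt t 0 with ht | ht
    · nlinarith [sq_nonneg r, sq_nonneg c]
    · calc c ^ 2 * t = (c * √t) ^ 2 := by rw [mul_pow, Real.sq_sqrt ht.le]
        _ ≤ r ^ 2 := by gcongr
  have htr' := hsq (by norm_num) htr
  have hlam' := hsq (by norm_num) hlam
  have hcond : 32 * (k / n * lambdaMax S) ≤ (r / 2) ^ 2 := by
    rcases le_or_gt (lambdaMax S) 0 with hneg | hpos
    · have : k / n * lambdaMax S ≤ 0 := mul_nonpos_of_nonneg_of_nonpos (by positivity) hneg
      nlinarith [sq_nonneg (r / 2)]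
    · have h1 : k / n * lambdaMax S ≤ 202 * (lambdaMax S * L / n) := by
        have : 202 * (lambdaMax S * L / n) = 202 * L / n * lambdaMax S := by ring
        rw [this]
        gcongr
      have h2 : 0 ≤ lambdaMax S * L / n := by positivity
      nlinarith
  have hexp : 16 * (k / n * S.trace) / (r / 2) ^ 2 - k / 8 ≤ Real.log δ := by
    have h1 : 16 * (k / n * S.trace) / (r / 2) ^ 2 ≤ k / 100 := by
      rw [div_le_iff₀ (by positivity)]
      have : k / n * S.trace = k * (S.trace / n) := by ring
      rw [this]
      nlinarith
    linarith
  calc P {ω | r < ‖μhat ω - μ‖}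
      ≤ P {ω | ∃ u : EuclideanSpace ℝ (Fin d), ‖u‖ = 1 ∧ (k : ℝ) / 2 ≤
          exceedCount (r / 2) (fun j => blockMean B (fun i => X i ω) j - μ) u} := by
        refine measure_mono fun ω hω => ?_
        by_contra hgood
        simp only [Set.mem_ofPred_eq, not_exists, not_and, not_le] at hgood
        exact (((norm_sub_le_of_mem_tournamentArgmin _ hk0 (hμhat ω) μ).trans
          (tournamentRadius_le _ hr.le hgood)).trans_lt hω).false
    _ ≤ ENNReal.ofReal (Real.exp (16 * (k / n * S.trace) / (r / 2) ^ 2 - k / 8)) :=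
        measure_exists_half_le_exceedCount_blockMean_le hindep hL2 hμ hS hB hn hk0 hkn
          (half_pos hr) hcond
    _ ≤ ENNReal.ofReal δ := by
        refine ENNReal.ofReal_le_ofReal ?_
        exact (Real.exp_le_exp.2 hexp).trans_eq (Real.exp_log hδ0)

end MedianOfMeans

theorem theorem3p2
    {Ω : Type*} [MeasurableSpace Ω] (P : Measure Ω) [IsProbabilityMeasure P]
    (d n k : ℕ) (δ : ℝ) (hδ0 : 0 < δ) (hδ1 : δ < 1)
    (hk : k = ⌈200 * Real.log (2 / δ)⌉₊) (hn : 0 < n) (hkn : k ∣ n)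
    (B : Fin k → Finset (Fin n)) (hB : MedianOfMeans.IsEqualPartition B)
    (X : Fin n → Ω → EuclideanSpace ℝ (Fin d))
    (hindep : iIndepFun X P)
    (hident : ∀ i j : Fin n, IdentDistrib (X i) (X j) P P)
    (hL2 : ∀ i, MemLp (X i) 2 P)
    (μ : EuclideanSpace ℝ (Fin d)) (hμ : ∀ i, ∫ ω, X i ω ∂P = μ)
    (S : Matrix (Fin d) (Fin d) ℝ) (hS : ∀ i, MedianOfMeans.covMatrix (X i) P = S) :
    -- the minimum defining the estimator is attained
    (∀ ω, (MedianOfMeans.tournamentArgmin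
      (MedianOfMeans.blockMean B (fun i => X i ω))).Nonempty) ∧
    -- every choice of minimizers satisfies the bound outside an event of probability at most `δ`
    ∀ μhat : Ω → EuclideanSpace ℝ (Fin d),
      (∀ ω, μhat ω ∈ MedianOfMeans.tournamentArgmin
        (MedianOfMeans.blockMean B (fun i => X i ω))) →
      P {ω | ¬ ‖μhat ω - μ‖ ≤
        max (960 * √(S.trace / n))
          (240 * √(MedianOfMeans.lambdaMax S * Real.log (2 / δ) / n))} ≤ ENNReal.ofReal δ := by
  have hk0 : 0 < k := by
    rw [hk, Nat.ceil_pos]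
    have : 1 < 2 / δ := by rw [lt_div_iff₀ hδ0]; linarith
    have := Real.log_pos this
    positivity
  refine ⟨fun ω => MedianOfMeans.tournamentArgmin_nonempty _ hk0, fun μhat hμhat => ?_⟩
  set r := max (960 * √(S.trace / n))
    (240 * √(MedianOfMeans.lambdaMax S * Real.log (2 / δ) / n)) with hr
  have hr0 : 0 ≤ r := le_max_of_le_left (by positivity)
  -- the radius `r` itself may vanish, so it is approached from above
  have hunion : {ω | ¬ ‖μhat ω - μ‖ ≤ r} =
      ⋃ N : ℕ, {ω | r + 1 / ((N : ℝ) + 1) < ‖μhat ω - μ‖} := by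
    ext ω
    simp only [Set.mem_ofPred_eq, not_le, Set.mem_iUnion]
    refine ⟨fun h => ?_, fun ⟨N, h⟩ => lt_trans (lt_add_of_pos_right _ (by positivity)) h⟩
    obtain ⟨N, hN⟩ := exists_nat_one_div_lt (sub_pos.2 h)
    exact ⟨N, by linarith⟩
  have hmono : Monotone fun N : ℕ => {ω | r + 1 / ((N : ℝ) + 1) < ‖μhat ω - μ‖} := by
    intro N M hNM ω hω
    change r + 1 / ((N : ℝ) + 1) < ‖μhat ω - μ‖ at hω
    change r + 1 / ((M : ℝ) + 1) < ‖μhat ω - μ‖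
    refine lt_of_le_of_lt ?_ hω
    gcongr
  rw [hunion, hmono.measure_iUnion]
  refine iSup_le fun N => ?_
  have hN : 0 < 1 / ((N : ℝ) + 1) := by positivity
  have hle : r ≤ r + 1 / ((N : ℝ) + 1) := le_add_of_nonneg_right hN.le
  exact MedianOfMeans.measure_lt_norm_sub_le hδ0 hδ1 hk hn hkn hB hindep hL2 hμ hS hμhat
    (add_pos_of_nonneg_of_pos hr0 hN) ((le_max_left _ _).trans hle) ((le_max_right _ _).trans hle)
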